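/- Let $C$ be an ordered field. A *$2$-ordered $C$-vector space* is a $C$-vector space $G$ with two total orderings $<_0,<_1$, each of which makes $G$ an ordered $C$-vector space. Put $G_\infty=G\cup\{\infty\}$ and $G_{\pm\infty}=G\cup\{-\infty,\infty\}$ with $-\infty<_iG<_i\infty$ for $i=0,1$. A *Hamel space* over $C$ is a pair $(G,v)$ with $G$ a $2$-ordered $C$-vector space and $v:G\to G_\infty$ a map such that, for all $x,y\in G$ and $\lambda\in C\setminus\{0\}$ (and with $v(\infty)=\infty$): (a) $v(x)=\infty$ iff $x=0$; (b) $v(x+y)\ge_0\min_0(v(x),v(y))$; (c) $v(\lambda x)=v(x)$; (d) if $0<_1x<_1y$, then $v(x)\ge_0v(y)$; (e) $v(v(x))=v(x)$; (f) $v(x)>_10$. It is *independent* if intervals $(a_k,b_k)_{i_k}=\{s\in G: a_k<_{i_k}s<_{i_k}b_k\}$ for finitely many distinct indices $i_k\in\{0,1\}$, with $a_k,b_k\in G_{\pm\infty}$ and $a_k<_{i_k}b_k$, always have a common point, and *dense* if for all $a<_0b$ in $G$ there is $c\in G$ with $a<_0v(c)<_0b$. View $(G,v)$ as a structure with underlying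 set $G_\infty$ in the language $\mathcal L_{\mathrm{Ham}}=\{0,+,(\lambda_c)_{c\in C},<_0,<_1,v,\infty\}$, where $\lambda_c$ is scalar multiplication by $c$ and $g+\infty=\infty+g=\infty+\infty=\lambda_c(\infty)=v(\infty)=\infty$. Let $T_{\mathrm{Ham}}$ be the $\mathcal L_{\mathrm{Ham}}$-theory whose models are (up to isomorphism) the independent and dense Hamel spaces over $C$, that is, the set of all sentences true in all of them; this is a complete theory. For a complete theory $T$ and a cardinal $\kappa$, an *ict-pattern with $\kappa$ rows* for $T$ in the single variable $x$ consists of formulas $\varphi_\alpha(x;y_\alpha)$ without parameters ($\alpha<\kappa$, $y_\alpha$ a finite tuple of variables) and tuples $b^\alpha_i$ ($\alpha<\kappa$, $i\in\mathbb N$) in some model of $T$ such that for every $\eta:\kappa\to\mathbb N$ there is an element $a$ of that model satisfying, for all $\alpha<\kappa$ and $i\in\mathbb N$: $\varphi_\alpha(a;b^\alpha_i)$ holds iff $i=\eta(\alpha)$. The dp-rank of $T$ is at least $\kappa$ iff such a pattern exists. $T$ is *strongly dependent* if there is no ict-pattern with $\aleph_0$ rows, *dp-minimal* if there is none with $2$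 rows, and of *finite dp-rank* if for some $k\in\mathbb N$ there is none with $k$ rows. **Theorem.** For every ordered field $C$, the theory $T_{\mathrm{Ham}}$ is not strongly dependent, it is not dp-minimal, and it does not have finite dp-rank. -/

import Mathlib

universe u v

namespace Hamel

/-- The strict ordering of `S ∪ {∞}` (`⊤` plays the role of `∞`) that extends the strict ordering
`r` of `S` by declaring `S < ∞`. -/
def ltTop {S : Type*} (r : S → S → Prop) : WithTop S → WithTop S → Prop
  | some a, some b => r a b
  | some _, none => True
  | none, _ => False

/-- The strict ordering of `S ∪ {-∞, ∞}` that extends the strict ordering `r` of `S` by declaring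
`-∞ < S < ∞`. -/
def ltBotTop {S : Type*} (r : S → S → Prop) : WithBot (WithTop S) → WithBot (WithTop S) → Prop
  | some a, some b => ltTop r a b
  | none, some _ => True
  | _, none => False

/-- The data and laws that make a vector space `G` over an ordered field `C` an
`I`-ordered `C`-vector space: a family of (total, strict) orderings `lt i` of `G`, each of which
makes `G` an ordered `C`-vector space. -/
structure IOrderedSpace (I : Type*) (C : Type*) [Field C] [LinearOrder C] [IsStrictOrderedRing C]
    (G : Type*) [AddCommGroup G] [Module C G] where
  lt : I → G → G → Prop
  lt_irrefl : ∀ i x, ¬ lt i x x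
  lt_trans : ∀ i x y z, lt i x y → lt i y z → lt i x z
  lt_total : ∀ i x y, lt i x y ∨ x = y ∨ lt i y x
  add_lt_add_right : ∀ i x y z, lt i x y → lt i (x + z) (y + z)
  smul_pos : ∀ i (c : C) x, 0 < c → lt i 0 x → lt i 0 (c • x)

namespace IOrderedSpace

variable {I C G : Type*} [Field C] [LinearOrder C] [IsStrictOrderedRing C]
  [AddCommGroup G] [Module C G]

/-- The interval `(a, b)_i` in `G`, with endpoints in `G ∪ {-∞, ∞}`. -/
def interval (O : IOrderedSpace I C G) (i : I) (a b : WithBot (WithTop G)) : Set G :=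
  {s | ltBotTop (O.lt i) a ((s : WithTop G) : WithBot (WithTop G)) ∧
    ltBotTop (O.lt i) ((s : WithTop G) : WithBot (WithTop G)) b}

/-- The orderings are independent: intervals with respect to finitely many distinct orderings,
with endpoints in `G ∪ {-∞, ∞}`, have a common point. -/
def Independent (O : IOrderedSpace I C G) : Prop :=
  ∀ (n : ℕ) (i : Fin n → I), Function.Injective i →
    ∀ a b : Fin n → WithBot (WithTop G), (∀ k, ltBotTop (O.lt (i k)) (a k) (b k)) →
      (⋂ k, O.interval (i k) (a k) (b k)).Nonempty

end IOrderedSpace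

/-- The extension of `v : G → G ∪ {∞}` to `G ∪ {∞}` by `v ∞ = ∞`. -/
def valTop {G : Type*} (v : G → WithTop G) : WithTop G → WithTop G
  | some x => v x
  | none => ⊤

/-- Hamel spaces over `C`: a `2`-ordered `C`-vector space with a Hamel valuation `val`.
For a total ordering, `a ≥ b` is written `¬ a < b`, and `c ≥ min (a, b)` is written
`¬ c < a ∨ ¬ c < b`. -/
structure HamelSpace (C : Type*) [Field C] [LinearOrder C] [IsStrictOrderedRing C]
    (G : Type*) [AddCommGroup G] [Module C G] extends IOrderedSpace (Fin 2) C G where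
  val : G → WithTop G
  val_eq_top_iff : ∀ x, val x = ⊤ ↔ x = 0
  val_add : ∀ x y, ¬ ltTop (lt 0) (val (x + y)) (val x) ∨ ¬ ltTop (lt 0) (val (x + y)) (val y)
  val_smul : ∀ (c : C) x, c ≠ 0 → val (c • x) = val x
  val_convex : ∀ x y, lt 1 0 x → lt 1 x y → ¬ ltTop (lt 0) (val x) (val y)
  val_idem : ∀ x, val x = valTop val (val x)
  val_pos : ∀ x, ltTop (lt 1) ((0 : G) : WithTop G) (val x)

/-- Function symbols of the language of Hamel spaces: `0`, `∞`, `+`, `λ_c` for `c ∈ C`, `v`. -/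
inductive HamFunctions (C : Type u) : ℕ → Type u
  | zero : HamFunctions C 0
  | infty : HamFunctions C 0
  | add : HamFunctions C 2
  | smul (c : C) : HamFunctions C 1
  | val : HamFunctions C 1

/-- Relation symbols of the language of Hamel spaces: `<_0` and `<_1`. -/
inductive HamRelations : ℕ → Type
  | lt (i : Fin 2) : HamRelations 2

/-- The language of Hamel spaces over `C`. -/
def LHam (C : Type u) : FirstOrder.Language.{u, 0} := ⟨HamFunctions C, HamRelations⟩

namespace HamelSpace

variable {C G : Type*} [Field C] [LinearOrder C] [IsStrictOrderedRing C]
  [AddCommGroup G] [Module C G]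

/-- The orderings `<_0` and `<_1` are independent. -/
def Independent (H : HamelSpace C G) : Prop := H.toIOrderedSpace.Independent

/-- The value set is dense in `(G, <_0)`. -/
def IsDense (H : HamelSpace C G) : Prop :=
  ∀ a b : G, H.lt 0 a b → ∃ c : G, ltTop (H.lt 0) (a : WithTop G) (H.val c) ∧
    ltTop (H.lt 0) (H.val c) (b : WithTop G)

/-- A Hamel space as a structure with underlying set `G ∪ {∞}`, where `∞` is the default value:
`x + ∞ = ∞ + x = λ_c ∞ = v ∞ = ∞` and `G <_i ∞`. -/
@[reducible]
def toStructure (H : HamelSpace C G) : (LHam C).Structure (WithTop G) where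
  funMap := fun {_} f => match f with
    | .zero => fun _ => ((0 : G) : WithTop G)
    | .infty => fun _ => ⊤
    | .add => fun x => x 0 + x 1
    | .smul c => fun x => WithTop.map (fun g : G => c • g) (x 0)
    | .val => fun x => valTop H.val (x 0)
  RelMap := fun {_} r => match r with
    | .lt i => fun x => ltTop (H.lt i) (x 0) (x 1)

end HamelSpace

/-- The theory of independent and dense Hamel spaces over `C`: all sentences that are true in
every such space. These spaces form an elementary class (all of the defining conditions are first
order over `G ∪ {∞}`), so up to isomorphism they are exactly the models of this theory. -/
def THam (C : Type u) [Field C] [LinearOrder C] [IsStrictOrderedRing C] : (LHam C).Theory :=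
  {φ | ∀ (G : Type u) [AddCommGroup G] [Module C G] (H : HamelSpace C G),
    H.Independent → H.IsDense →
      letI := H.toStructure
      FirstOrder.Language.Sentence.Realize (WithTop G) φ}

section DpRank

variable {L : FirstOrder.Language.{u, v}}

/-- There is an ict-pattern for `T` in `n` variables whose rows are indexed by `ι`: formulas
`φ α (x; y_α)` with `|x| = n` and an array of parameter tuples `b α i` (`α : ι`, `i : ℕ`) such that
for every `η : ι → ℕ` some tuple `a` satisfies `φ α (a; b α i)` exactly when `i = η α`.
For complete `T`, such a pattern exists in some model if and only if it exists in the monster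
model; by the downward Löwenheim–Skolem theorem the universe of the model is no restriction
when `ι` is countable. For such `T`, a pattern with `κ` rows exists if and only if the dp-rank of
the formula `x = x` is at least `κ`. -/
def HasIctPattern (T : L.Theory) (n : ℕ) (ι : Type) : Prop :=
  ∃ (M : FirstOrder.Language.Theory.ModelType.{u, v, max u v} T) (m : ι → ℕ)
    (φ : ∀ α, L.Formula (Fin n ⊕ Fin (m α))) (b : ∀ α, ℕ → Fin (m α) → M),
    ∀ η : ι → ℕ, ∃ a : Fin n → M, ∀ α i, (φ α).Realize (Sum.elim a (b α i)) ↔ i = η α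

/-- `T` is strongly dependent: no ict-pattern with infinitely many rows in a single variable.
(Asking for this in all finite tuples of variables is equivalent, by subadditivity of dp-rank,
so that failure in a single variable is formally the strongest way to fail. The condition
implies NIP.) -/
def IsStronglyDependent (T : L.Theory) : Prop := ¬ HasIctPattern T 1 ℕ

/-- `T` is dp-minimal: the dp-rank of `x = x`, for a single variable `x`, is at most `1`. -/
def IsDpMinimal (T : L.Theory) : Prop := ¬ HasIctPattern T 1 (Fin 2)

/-- `T` has finite dp-rank: the dp-rank of `x = x`, for a single variable `x`, is less than some
natural number. -/
def HasFiniteDpRank (T : L.Theory) : Prop := ∃ k : ℕ, ¬ HasIctPattern T 1 (Fin k)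

end DpRank

end Hamel

/-! With f(x) = x - v(x), the formulas v(f^n(x)) = y read off the summands of x = e_0 + ... +
e_{k-1}, where e_0 < e_1 < ... are basis vectors and v picks the first one present. Each summand can
be chosen freely from its own row of basis vectors, provided the rows lie one above the other. This
gives patterns with any finite number of rows over one fixed array, and an ultrapower yields
infinitely many rows (`hasIctPattern_nat_of_finite`). Restricting the rows refutes dp-minimality and
finite dp-rank as well.

What remains is one explicit model. Take an ordered space V with a linearly independent set B dense
in V (`exists_dense_linearIndependent`). On the span of B, let <_0 come from V, let <_1 be
lexicographic in B-coordinates, and let v be the leading basis vector. Density of B gives both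
density and independence (`spanHamel_independent`). -/

namespace Hamel

/-! ### The Hamel space spanned by a dense independent set -/

section SpanModel

variable {C V : Type*} [Field C] [AddCommGroup V] [Module C V] [LinearOrder V]

/-- The leading basis vector of a finitely supported function on a linear order `ι`, and `∞` for
the zero function. -/
noncomputable def leading {ι : Type*} [LinearOrder ι] (x : ι →₀ C) : WithTop (ι →₀ C) :=
  x.support.min.map fun i => Finsupp.single i 1

theorem leading_eq_top_iff {ι : Type*} [LinearOrder ι] {x : ι →₀ C} : leading x = ⊤ ↔ x = 0 := by
  simp [leading, WithTop.map_eq_top_iff, Finset.min_eq_top]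

theorem leading_single {ι : Type*} [LinearOrder ι] (i : ι) :
    leading (Finsupp.single i (1 : C)) = (Finsupp.single i (1 : C) : ι →₀ C) := by
  rw [leading, Finsupp.support_single i one_ne_zero, Finset.min_singleton]
  rfl

theorem leading_of_ne_zero {ι : Type*} [LinearOrder ι] {x : ι →₀ C} (hx : x ≠ 0) :
    ∃ i, leading x = (Finsupp.single i (1 : C) : ι →₀ C) := by
  obtain ⟨i, hi⟩ := Finset.min_of_nonempty (Finsupp.support_nonempty_iff.2 hx)
  exact ⟨i, by rw [leading, hi]; rfl⟩

theorem leading_eq_single {ι : Type*} [LinearOrder ι] {x : ι →₀ C} {i : ι} (hi : x i ≠ 0)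
    (h : ∀ j < i, x j = 0) : leading x = (Finsupp.single i (1 : C) : ι →₀ C) := by
  have : x.support.min = i := by
    refine le_antisymm (Finset.min_le (Finsupp.mem_support_iff.2 hi)) (Finset.le_min fun j hj => ?_)
    exact WithTop.coe_le_coe.2 (not_lt.1 fun hlt => Finsupp.mem_support_iff.1 hj (h j hlt))
  rw [leading, this]
  rfl

variable {B : Set V} [LinearOrder C]

/-- The linear map sending the basis vector indexed by `b ∈ B` to `b`. -/
noncomputable abbrev evalSpan (C : Type*) [Field C] [Module C V] (B : Set V) :
    (B →₀ C) →ₗ[C] V :=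
  Finsupp.linearCombination C (fun b : B => (b : V))

/-- The ordering of the span of `B` induced from `V` (index `0`), and its lexicographic
ordering with respect to the basis `B` (index `1`). -/
def spanLt (C : Type*) [Field C] [LinearOrder C] [Module C V] (B : Set V) :
    Fin 2 → (B →₀ C) → (B →₀ C) → Prop
  | 0, x, y => evalSpan C B x < evalSpan C B y
  | 1, x, y => toLex x < toLex y

theorem spanLt_zero {x y : B →₀ C} : spanLt C B 0 x y ↔ evalSpan C B x < evalSpan C B y := Iff.rfl

theorem spanLt_one {x y : B →₀ C} :
    spanLt C B 1 x y ↔ ∃ i, (∀ j < i, x j = y j) ∧ x i < y i := Iff.rfl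

/-- Evaluation sends the basis vector of `b` to `b`, so values are ordered like their indices; the
empty support has minimum `⊤`, matching ∞. -/
theorem ltTop_leading_iff {x y : B →₀ C} :
    ltTop (spanLt C B 0) (leading x) (leading y) ↔ x.support.min < y.support.min := by
  unfold leading
  rcases x.support.min with _ | i <;> rcases y.support.min with _ | j
  · exact iff_of_false id (lt_irrefl _)
  · exact iff_of_false id (not_lt_of_ge le_top)
  · exact iff_of_true trivial (WithTop.coe_lt_top _)
  · refine Iff.trans ?_ (WithTop.coe_lt_coe (a := j) (b := i)).symm
    change evalSpan C B (Finsupp.single i 1) < evalSpan C B (Finsupp.single j 1) ↔ _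
    simp

variable [IsStrictOrderedRing C] [IsOrderedAddMonoid V] [PosSMulStrictMono C V]

/-- The space with basis `B` as a `2`-ordered space. -/
noncomputable def spanOrdered (hB : LinearIndependent C (fun b : B => (b : V))) :
    IOrderedSpace (Fin 2) C (B →₀ C) where
  lt := spanLt C B
  lt_irrefl i x := by
    fin_cases i
    · exact lt_irrefl _
    · exact lt_irrefl (toLex x)
  lt_trans i x y z := by
    fin_cases i
    · exact lt_trans
    · exact lt_trans (a := toLex x)
  lt_total i x y := by
    fin_cases i
    · rcases lt_trichotomy (evalSpan C B x) (evalSpan C B y) with h | h | h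
      exacts [.inl h, .inr (.inl (hB h)), .inr (.inr h)]
    · exact lt_trichotomy (toLex x) (toLex y)
  add_lt_add_right i x y z h := by
    fin_cases i
    · have : evalSpan C B x < evalSpan C B y := h
      change evalSpan C B (x + z) < evalSpan C B (y + z)
      simpa using this
    · exact add_lt_add_left (show toLex x < toLex y from h) (toLex z)
  smul_pos i c x hc h := by
    fin_cases i
    · have h : evalSpan C B 0 < evalSpan C B x := h
      change evalSpan C B 0 < evalSpan C B (c • x)
      rw [map_zero] at h ⊢
      rw [map_smul]
      exact _root_.smul_pos hc h
    · obtain ⟨j, hj, hlt⟩ := spanLt_one.1 h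
      refine spanLt_one.2 ⟨j, fun k hk => ?_, ?_⟩
      · simp [← hj k hk]
      · simpa using mul_pos hc hlt

/-- The Hamel space with basis `B`. -/
noncomputable def spanHamel (hB : LinearIndependent C (fun b : B => (b : V))) :
    HamelSpace C (B →₀ C) where
  toIOrderedSpace := spanOrdered hB
  val := leading
  val_eq_top_iff _ := leading_eq_top_iff
  val_add x y := by
    classical
    change ¬ ltTop (spanLt C B 0) _ _ ∨ ¬ ltTop (spanLt C B 0) _ _
    rw [ltTop_leading_iff, ltTop_leading_iff, not_lt, not_lt, ← min_le_iff]
    refine le_trans (le_of_eq ?_) (Finset.min_mono Finsupp.support_add)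
    convert Finset.min_union.symm
  val_smul c x hc := by
    unfold leading
    rw [Finsupp.support_smul_eq hc]
  val_convex x y h0 hxy := by
    change ¬ ltTop (spanLt C B 0) _ _
    rw [ltTop_leading_iff]
    intro hlt
    obtain ⟨i, hi, hi0⟩ := spanLt_one.1 h0
    have hxi : i ∈ x.support := Finsupp.mem_support_iff.2 hi0.ne'
    have hy : ∀ j ≤ i, y j = 0 := fun j hj => by
      by_contra h
      have hmin : x.support.min = i := by
        refine le_antisymm (Finset.min_le hxi) (Finset.le_min fun k hk => ?_)
        exact WithTop.coe_le_coe.2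
          (not_lt.1 fun hlt => Finsupp.mem_support_iff.1 hk (hi k hlt).symm)
      rw [hmin] at hlt
      exact absurd (hlt.trans_le (Finset.min_le (Finsupp.mem_support_iff.2 h)))
        (not_lt.2 (WithTop.coe_le_coe.2 hj))
    -- `x` is positive at its leading index `i`, while `y` vanishes up to and including `i`.
    have hyx : toLex y < toLex x :=
      ⟨i, fun j hj => (hy j hj.le).trans (hi j hj), (hy i le_rfl).trans_lt hi0⟩
    exact lt_asymm (show toLex x < toLex y from hxy) hyx
  val_idem x := by
    by_cases hx : x = 0
    · rw [leading_eq_top_iff.2 hx]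
      rfl
    · obtain ⟨i, hi⟩ := leading_of_ne_zero hx
      rw [hi]
      exact (leading_single i).symm
  val_pos x := by
    by_cases hx : x = 0
    · rw [leading_eq_top_iff.2 hx]
      trivial
    · obtain ⟨i, hi⟩ := leading_of_ne_zero hx
      rw [hi]
      refine spanLt_one.2 ⟨i, fun j hj => ?_, by simp⟩
      simp [hj.ne']

theorem spanHamel_isDense (hB : LinearIndependent C (fun b : B => (b : V)))
    (hd : ∀ a b : V, a < b → ∃ e ∈ B, a < e ∧ e < b) : (spanHamel hB).IsDense := by
  intro a b hab
  obtain ⟨e, he, h1, h2⟩ := hd _ _ (spanLt_zero.1 hab)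
  have hv : (spanHamel hB).val (Finsupp.single ⟨e, he⟩ 1) =
      (Finsupp.single (⟨e, he⟩ : B) (1 : C) : B →₀ C) := leading_single _
  refine ⟨Finsupp.single ⟨e, he⟩ 1, ?_, ?_⟩ <;> rw [hv]
  · exact spanLt_zero.2 (by simpa using h1)
  · exact spanLt_zero.2 (by simpa using h2)

/-- In a nontrivial ordered space, every interval contains a nonempty one with endpoints in the
space. -/
theorem IOrderedSpace.exists_bounded_interval {I C G : Type*} [Field C] [LinearOrder C]
    [IsStrictOrderedRing C] [AddCommGroup G] [Module C G] [Nontrivial G]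
    (O : IOrderedSpace I C G) (i : I) {a b : WithBot (WithTop G)} (h : ltBotTop (O.lt i) a b) :
    ∃ c d : G, O.lt i c d ∧ ∀ s, O.lt i c s → O.lt i s d → s ∈ O.interval i a b := by
  obtain ⟨g, hg⟩ : ∃ g : G, O.lt i 0 g := by
    obtain ⟨g, hg⟩ := exists_ne (0 : G)
    rcases O.lt_total i 0 g with h | h | h
    · exact ⟨g, h⟩
    · exact absurd h.symm hg
    · exact ⟨-g, by simpa using O.add_lt_add_right i _ _ (-g) h⟩
  rcases a with _ | _ | a <;> rcases b with _ | _ | b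
  · exact h.elim
  · exact ⟨0, g, hg, fun s _ _ => ⟨trivial, trivial⟩⟩
  · exact ⟨b - g, b, by simpa using O.add_lt_add_right i _ _ (b - g) hg,
      fun s _ h2 => ⟨trivial, h2⟩⟩
  · exact h.elim
  · exact h.elim
  · exact h.elim
  · exact h.elim
  · exact ⟨a, g + a, by simpa using O.add_lt_add_right i _ _ a hg, fun s h1 _ => ⟨h1, trivial⟩⟩
  · exact ⟨a, b, h, fun s h1 h2 => ⟨h1, h2⟩⟩

/-- Two orderings are independent as soon as bounded intervals meet. -/
theorem IOrderedSpace.independent_of_inter {C G : Type*} [Field C] [LinearOrder C]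
    [IsStrictOrderedRing C] [AddCommGroup G] [Module C G] [Nontrivial G]
    (O : IOrderedSpace (Fin 2) C G)
    (h : ∀ a b c d : G, O.lt 0 a b → O.lt 1 c d →
      ∃ s, (O.lt 0 a s ∧ O.lt 0 s b) ∧ O.lt 1 c s ∧ O.lt 1 s d) : O.Independent := by
  intro n i hi a b hab
  -- An ordering not listed by `i` receives the interval (-∞, ∞), so both orderings can be treated
  -- together.
  have hext : ∀ j, ltBotTop (O.lt j) (Function.extend i a (fun _ => ⊥) j)
      (Function.extend i b (fun _ => ((⊤ : WithTop G) : WithBot (WithTop G))) j) := fun j => by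
    by_cases hj : ∃ k, i k = j
    · obtain ⟨k, rfl⟩ := hj
      rw [hi.extend_apply, hi.extend_apply]
      exact hab k
    · rw [Function.extend_apply' _ _ _ hj, Function.extend_apply' _ _ _ hj]
      trivial
  choose c d hcd hsub using fun j => O.exists_bounded_interval j (hext j)
  obtain ⟨s, h0, h1⟩ := h _ _ _ _ (hcd 0) (hcd 1)
  have hs : ∀ j, O.lt j (c j) s ∧ O.lt j s (d j) := by
    intro j
    fin_cases j
    exacts [h0, h1]
  refine ⟨s, Set.mem_iInter.2 fun k => ?_⟩
  have := hsub (i k) s (hs (i k)).1 (hs (i k)).2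
  rwa [hi.extend_apply, hi.extend_apply] at this

/-- A lexicographic interval is insensitive to coordinates beyond a deciding index `i`. Adding `b₂ -
b₁` with both indices beyond `i` therefore stays inside it, and density of `B` lets this difference
move the evaluation into the other interval. -/
theorem spanHamel_independent [Nontrivial V] (hB : LinearIndependent C (fun b : B => (b : V)))
    (hd : ∀ a b : V, a < b → ∃ e ∈ B, a < e ∧ e < b) : (spanHamel hB).Independent := by
  obtain ⟨x, hx⟩ := exists_gt (0 : V)
  obtain ⟨e, he, -, -⟩ := hd _ _ hx
  have : Nonempty B := ⟨⟨e, he⟩⟩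
  refine IOrderedSpace.independent_of_inter _ fun a b c d hab hcd => ?_
  obtain ⟨i, hi, hlt⟩ := spanLt_one.1 hcd
  have hab : evalSpan C B a < evalSpan C B b := hab
  obtain ⟨t, htc, htd⟩ := exists_between hlt
  set g : B →₀ C := c + Finsupp.single i (t - c i) with hg
  -- The second bound makes the lower end of the window for `b₂` exceed `i`.
  obtain ⟨z, hz⟩ := exists_gt (max (i : V) (i + evalSpan C B g - evalSpan C B a))
  obtain ⟨b₁, hb₁, h1, -⟩ := hd _ _ hz
  obtain ⟨b₂, hb₂, h2, h3⟩ := hd (b₁ + evalSpan C B a - evalSpan C B g)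
    (b₁ + evalSpan C B b - evalSpan C B g) (by gcongr)
  have hi1 : i < ⟨b₁, hb₁⟩ := show (i : V) < b₁ from (le_max_left _ _).trans_lt h1
  have hi2 : i < ⟨b₂, hb₂⟩ := by
    have h4 := (le_max_right _ _).trans_lt h1
    change (i : V) < b₂
    refine lt_trans ?_ h2
    rw [sub_lt_iff_lt_add] at h4
    rwa [lt_sub_iff_add_lt]
  set s : B →₀ C := g + (Finsupp.single ⟨b₂, hb₂⟩ 1 - Finsupp.single ⟨b₁, hb₁⟩ 1) with hs
  have hsj : ∀ j < i, s j = c j := fun j hj => by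
    simp [hs, hg, hj.ne', (hj.trans hi1).ne', (hj.trans hi2).ne']
  have hsi : s i = t := by
    simp [hs, hg, hi1.ne', hi2.ne']
  have hev : evalSpan C B s = evalSpan C B g + (b₂ - b₁) := by
    simp [hs]
  refine ⟨s, ⟨spanLt_zero.2 ?_, spanLt_zero.2 ?_⟩, spanLt_one.2 ⟨i, fun j hj => (hsj j hj).symm, ?_⟩,
    spanLt_one.2 ⟨i, fun j hj => (hsj j hj).trans (hi j hj), ?_⟩⟩
  · rw [hev]
    rw [sub_lt_iff_lt_add] at h2
    rw [← sub_pos] at h2 ⊢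
    convert h2 using 1
    abel
  · rw [hev]
    rw [lt_sub_iff_add_lt] at h3
    rw [← sub_pos] at h3 ⊢
    convert h3 using 1
    abel
  · rwa [hsi]
  · rwa [hsi]

end SpanModel

/-! ### A dense linearly independent set -/

section DenseBasis

variable {C : Type u} [Field C] [LinearOrder C] [IsStrictOrderedRing C]

/-- The index set of the lexicographic space in which a dense basis is constructed. -/
abbrev LexIndex (C : Type u) : Type u := ℕ ×ₗ C

instance : PosSMulStrictMono C (Lex (LexIndex C →₀ C)) where
  smul_lt_smul_of_pos_left c hc x y h := by
    obtain ⟨i, hi, hlt⟩ := h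
    refine ⟨i, fun j hj => ?_, ?_⟩
    · exact congrArg (c * ·) (hi j hj)
    · exact mul_lt_mul_of_pos_left hlt hc

variable (C) in
/-- Finitely supported functions can be assigned distinct indices beyond their supports. -/
theorem exists_fresh_index : ∃ m : (LexIndex C →₀ C) → LexIndex C, Function.Injective m ∧
    ∀ a, ∀ i ∈ a.support, i < m a := by
  have hC : Cardinal.mk (LexIndex C →₀ C) = Cardinal.mk C := by
    have : Infinite (LexIndex C) := inferInstanceAs (Infinite (ℕ × C))
    have hI : Cardinal.mk (LexIndex C) = Cardinal.mk C := by
      change Cardinal.mk (ℕ × C) = _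
      rw [Cardinal.mk_prod]
      simp [Cardinal.aleph0_mul_eq]
    rw [Cardinal.mk_finsupp_of_infinite, hI, max_self]
  obtain ⟨f⟩ := Cardinal.eq.1 hC
  -- The first coordinate passes the support; the second encodes `a` and gives injectivity.
  refine ⟨fun a => toLex (a.support.sup (fun i => (ofLex i).1) + 1, f a), fun a b h => ?_,
    fun a i hi => ?_⟩
  · exact f.injective (congrArg (fun i : LexIndex C => (ofLex i).2) h)
  · exact Prod.Lex.left _ _
      (Nat.lt_succ_of_le (Finset.le_sup (f := fun i : LexIndex C => (ofLex i).1) hi))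

variable (C) in
/-- There is an ordered vector space with a linearly independent set that is dense in the
ordering. -/
theorem exists_dense_linearIndependent : ∃ B : Set (Lex (LexIndex C →₀ C)),
    LinearIndependent C (fun b : B => (b : Lex (LexIndex C →₀ C))) ∧
      ∀ x y : Lex (LexIndex C →₀ C), x < y → ∃ e ∈ B, x < e ∧ e < y := by
  obtain ⟨m, hm, hlt⟩ := exists_fresh_index C
  have hfresh : ∀ a i, m a ≤ i → a i = 0 := fun a i hi => by
    by_contra h
    exact absurd (hlt a i (Finsupp.mem_support_iff.2 h)) (not_lt.2 hi)
  let F : (LexIndex C →₀ C) → (LexIndex C →₀ C) := fun a => a + Finsupp.single (m a) 1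
  have hF : LinearIndependent C F := by
    rw [linearIndependent_iff]
    intro l hl
    by_contra h0
    -- At the largest fresh index `m a` only `F a` has a nonzero coordinate, so the coefficient of
    -- `a` would vanish.
    obtain ⟨a, ha, hmax⟩ := l.support.exists_max_image m (Finsupp.support_nonempty_iff.2 h0)
    have h1 := DFunLike.congr_fun hl (m a)
    rw [Finsupp.linearCombination_apply, Finsupp.sum, Finsupp.finsetSum_apply,
      Finset.sum_eq_single_of_mem a ha] at h1
    · simp [F, hfresh a (m a) le_rfl] at h1
      exact Finsupp.mem_support_iff.1 ha h1
    · intro b hb hba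
      simp [F, hfresh b (m a) (hmax b hb), hm.ne hba]
  refine ⟨Set.range (fun a => toLex (F a)), ?_, ?_⟩
  · have : LinearIndependent C (fun a => toLex (F a)) := hF
    exact this.linearIndepOn_id
  · rintro x y ⟨i, hi, hxy⟩
    -- `c ≠ 0` puts `i` in the support of `a`, so the fresh index lies beyond `i` and does not
    -- disturb the comparison.
    obtain ⟨c, ⟨hc1, hc2⟩, hc0⟩ := (Set.Ioo_infinite hxy).exists_notMem_finset {0}
    rw [Finset.mem_singleton] at hc0
    let a : LexIndex C →₀ C := ofLex x + Finsupp.single i (c - ofLex x i)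
    have hai : a i = c := by simp [a]
    have him : i < m a := hlt a i (Finsupp.mem_support_iff.2 (hai ▸ hc0))
    have hFi : F a i = c := by simp [F, hai, him.ne']
    have hFj : ∀ j < i, F a j = ofLex x j := fun j hj => by
      have haj : a j = ofLex x j := by simp [a, hj.ne']
      simp [F, haj, (hj.trans him).ne']
    refine ⟨_, ⟨a, rfl⟩, ⟨i, fun j hj => (hFj j hj).symm, ?_⟩,
      ⟨i, fun j hj => (hFj j hj).trans (hi j hj), ?_⟩⟩
    · exact hc1.trans_eq hFi.symm
    · exact hFi.trans_lt hc2

end DenseBasis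

/-! ### Reading off summands by iterating x - v x -/

section Iterates

open FirstOrder FirstOrder.Language

variable {C : Type u} [Field C] [LinearOrder C] [IsStrictOrderedRing C]

/-- The term `t + λ₋₁ (v t)`. -/
def subValTerm {α : Type*} (t : (LHam C).Term α) : (LHam C).Term α :=
  .func (L := LHam C) (l := 2) HamFunctions.add
    ![t, .func (L := LHam C) (l := 1) (HamFunctions.smul (-1 : C))
      ![.func (L := LHam C) (l := 1) HamFunctions.val ![t] ] ]

/-- The formula `v (fⁿ x) = y` in the variables `(x; y)`, where `f x = x - v x`. -/
def valIterFormula (C : Type u) [Field C] [LinearOrder C] [IsStrictOrderedRing C] (n : ℕ) :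
    (LHam C).Formula (Fin 1 ⊕ Fin 1) :=
  Term.equal (.func (L := LHam C) (l := 1) HamFunctions.val ![subValTerm^[n] (.var (.inl 0))])
    (.var (.inr 0))

variable {G : Type*} [AddCommGroup G] [Module C G] (H : HamelSpace C G)

theorem realize_subValTerm {α : Type*} (t : (LHam C).Term α) (e : α → WithTop G) {x y : G}
    (hx : letI := H.toStructure; t.realize e = (x : WithTop G)) (hy : H.val x = (y : WithTop G)) :
    letI := H.toStructure
    (subValTerm t).realize e = ((x - y : G) : WithTop G) := by
  let := H.toStructure
  change t.realize e + WithTop.map (fun g : G => (-1 : C) • g) (valTop H.val (t.realize e)) = _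
  rw [hx]
  change (x : WithTop G) + WithTop.map (fun g : G => (-1 : C) • g) (H.val x) = _
  rw [hy]
  change ((x + (-1 : C) • y : G) : WithTop G) = _
  rw [neg_one_smul, sub_eq_add_neg]

theorem realize_valIterFormula (n : ℕ) (x : ℕ → G) (y : ℕ → G)
    (hv : ∀ j ≤ n, H.val (x j) = (y j : WithTop G)) (hs : ∀ j < n, x (j + 1) = x j - y j)
    (z : WithTop G) :
    letI := H.toStructure
    (valIterFormula C n).Realize (Sum.elim (fun _ => (x 0 : WithTop G)) fun _ => z) ↔
      (y n : WithTop G) = z := by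
  let := H.toStructure
  have h : ∀ j ≤ n, (subValTerm^[j] (.var (.inl 0) : (LHam C).Term (Fin 1 ⊕ Fin 1))).realize
      (Sum.elim (fun _ => (x 0 : WithTop G)) fun _ => z) = (x j : WithTop G) := by
    intro j
    induction j with
    | zero => exact fun _ => rfl
    | succ j ih =>
      intro hj
      rw [Function.iterate_succ_apply', hs j hj]
      exact realize_subValTerm H _ _ (ih (Nat.le_of_succ_le hj)) (hv j (Nat.le_of_succ_le hj))
  rw [valIterFormula, Formula.realize_equal]
  change valTop H.val (Term.realize _ (subValTerm^[n] (.var (.inl 0) : (LHam C).Term (Fin 1 ⊕ Fin 1)))) = z ↔ _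
  rw [h n le_rfl]
  change H.val (x n) = z ↔ _
  rw [hv n le_rfl]

/-- A sum of basis vectors in increasing order realizes the formulas `v (fⁿ x) = y` with `y` its
`n`-th summand. -/
theorem realize_valIterFormula_spanHamel {V : Type*} [AddCommGroup V] [Module C V] [LinearOrder V]
    [IsOrderedAddMonoid V] [PosSMulStrictMono C V] {B : Set V}
    (hB : LinearIndependent C (fun b : B => (b : V))) {p : ℕ → B} (hp : StrictMono p)
    {n k : ℕ} (hn : n < k) (q : B) :
    letI := (spanHamel hB).toStructure
    (valIterFormula C n).Realize (M := WithTop (B →₀ C)) (Sum.elim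
      (fun _ => ((∑ j ∈ Finset.Ico 0 k, Finsupp.single (p j) (1 : C) : B →₀ C) : WithTop (B →₀ C)))
      fun _ => ((Finsupp.single q (1 : C) : B →₀ C) : WithTop (B →₀ C))) ↔ p n = q := by
  let := (spanHamel hB).toStructure
  -- The iterates are the tails of the sum: each step removes the leading summand.
  rw [realize_valIterFormula (spanHamel hB) n
    (fun i => ∑ j ∈ Finset.Ico i k, Finsupp.single (p j) (1 : C))
    (fun i => Finsupp.single (p i) (1 : C))]
  · rw [WithTop.coe_inj, Finsupp.single_left_inj one_ne_zero]
  · intro j hj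
    refine leading_eq_single ?_ ?_
    · rw [Finsupp.finsetSum_apply, Finset.sum_eq_single_of_mem j
        (Finset.mem_Ico.2 ⟨le_rfl, hj.trans_lt hn⟩)]
      · simp
      · intro i _ hij
        simp [hp.injective.ne hij]
    · intro b hb
      rw [Finsupp.finsetSum_apply]
      refine Finset.sum_eq_zero fun i hi => ?_
      have : b < p i := hb.trans_le (hp.monotone (Finset.mem_Ico.1 hi).1)
      simp [this.ne']
  · intro j hj
    rw [Finset.sum_eq_sum_Ico_succ_bot (hj.trans hn), add_sub_cancel_left]

end Iterates

/-! ### From finite patterns to infinitely many rows -/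

section Patterns

open FirstOrder FirstOrder.Language

variable {L : FirstOrder.Language.{u, v}} {T : L.Theory}

theorem HasIctPattern.of_injective {n : ℕ} {ι κ : Type} (h : HasIctPattern T n ι) {f : κ → ι}
    (hf : Function.Injective f) : HasIctPattern T n κ := by
  obtain ⟨M, m, φ, b, h⟩ := h
  refine ⟨M, m ∘ f, fun α => φ (f α), fun α => b (f α), fun η => ?_⟩
  obtain ⟨a, ha⟩ := h (Function.extend f η 0)
  refine ⟨a, fun α i => ?_⟩
  rw [ha, hf.extend_apply]

/-- If one array of parameters in a model works for any finite number of rows, then the theory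
has a pattern with rows indexed by `ℕ`, in an ultrapower of that model. -/
theorem hasIctPattern_nat_of_finite (M : Type (max u v)) [L.Structure M] [M ⊨ T] [Nonempty M]
    {n : ℕ} (m : ℕ → ℕ) (φ : ∀ j, L.Formula (Fin n ⊕ Fin (m j))) (b : ∀ j, ℕ → Fin (m j) → M)
    (h : ∀ (k : ℕ) (η : ℕ → ℕ), ∃ a : Fin n → M, ∀ j < k, ∀ i,
      (φ j).Realize (Sum.elim a (b j i)) ↔ i = η j) : HasIctPattern T n ℕ := by
  let U : Ultrafilter ℕ := Filter.hyperfilter ℕ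
  let N := (U : Filter ℕ).Product fun _ => M
  have : N ⊨ T := ⟨fun ψ hψ => (Ultraproduct.sentence_realize ψ).2
    (Filter.Eventually.of_forall fun _ => Theory.realize_sentence_of_mem T hψ)⟩
  refine ⟨Theory.ModelType.of T N, m, φ, fun j i l => ((fun _ => b j i l : ℕ → M) : N),
    fun η => ?_⟩
  choose a ha using fun k => h k η
  refine ⟨fun l => ((fun k => a k l : ℕ → M) : N), fun j i => ?_⟩
  have key := Ultraproduct.realize_formula_cast (u := U) (M := fun _ => M) (φ j)
    (Sum.elim (fun l k => a k l) fun l _ => b j i l)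
  have hev : ∀ᶠ k in (U : Filter ℕ), ((φ j).Realize
      (fun s => Sum.elim (fun l k => a k l) (fun l _ => b j i l) s k) ↔ i = η j) := by
    -- Row `j` is correct in every factor `k > j`, hence in almost all factors.
    refine Nat.hyperfilter_le_atTop ?_
    filter_upwards [Filter.eventually_gt_atTop j] with k hk
    rw [← ha k j hk i]
    refine iff_of_eq (congrArg _ (funext fun s => ?_))
    cases s <;> rfl
  rw [Filter.eventually_congr hev, Filter.eventually_const] at key
  rw [← key]
  refine iff_of_eq (congrArg _ (funext fun s => ?_))
  cases s <;> rfl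

theorem HamelSpace.model_THam {C G : Type u} [Field C] [LinearOrder C] [IsStrictOrderedRing C]
    [AddCommGroup G] [Module C G] (H : HamelSpace C G) (hi : H.Independent) (hd : H.IsDense) :
    letI := H.toStructure
    WithTop G ⊨ THam C :=
  letI := H.toStructure
  ⟨fun _ hφ => hφ G H hi hd⟩

theorem hasIctPattern_THam_nat (C : Type u) [Field C] [LinearOrder C] [IsStrictOrderedRing C] :
    HasIctPattern (THam C) 1 ℕ := by
  obtain ⟨B, hB, hd⟩ := exists_dense_linearIndependent C
  have : Nonempty (LexIndex C) := ⟨toLex (0, 0)⟩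
  have : Nontrivial (Lex (LexIndex C →₀ C)) := inferInstanceAs (Nontrivial (LexIndex C →₀ C))
  let := (spanHamel hB).toStructure
  have := (spanHamel hB).model_THam (spanHamel_independent hB hd) (spanHamel_isDense hB hd)
  have : DenselyOrdered B := ⟨fun x y hxy => by
    obtain ⟨e, he, h1, h2⟩ := hd x y hxy
    exact ⟨⟨e, he⟩, h1, h2⟩⟩
  have : Nontrivial B := by
    obtain ⟨x, hx⟩ := exists_gt (0 : Lex (LexIndex C →₀ C))
    obtain ⟨e, he, h1, -⟩ := hd _ _ hx
    obtain ⟨e', he', -, h2⟩ := hd _ _ h1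
    exact ⟨⟨e, he⟩, ⟨e', he'⟩, fun h => h2.ne' (congrArg Subtype.val h)⟩
  have : Countable (ℕ ×ₗ ℕ) := inferInstanceAs (Countable (ℕ × ℕ))
  obtain ⟨p⟩ := Order.embedding_from_countable_to_dense (ℕ ×ₗ ℕ) B
  refine hasIctPattern_nat_of_finite (WithTop (B →₀ C)) (fun _ => 1) (valIterFormula C)
    (fun j i _ => ((Finsupp.single (p (toLex (j, i))) (1 : C) : B →₀ C) : WithTop (B →₀ C)))
    fun k η => ?_
  have hp : StrictMono fun j => p (toLex (j, η j)) := fun j j' hj =>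
    p.strictMono (Prod.Lex.left _ _ hj)
  refine ⟨_, fun j hj i => (realize_valIterFormula_spanHamel hB hp hj _).trans ?_⟩
  rw [p.injective.eq_iff, EmbeddingLike.apply_eq_iff_eq, Prod.mk.injEq]
  exact ⟨fun h => h.2.symm, fun h => ⟨rfl, h.symm⟩⟩

end Patterns

end Hamel

theorem theorem6p1 (C : Type u) [Field C] [LinearOrder C] [IsStrictOrderedRing C] :
    ¬ Hamel.IsStronglyDependent (Hamel.THam C) ∧
      ¬ Hamel.IsDpMinimal (Hamel.THam C) ∧
      ¬ Hamel.HasFiniteDpRank (Hamel.THam C) :=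
  have h := Hamel.hasIctPattern_THam_nat C
  ⟨fun hT => hT h, fun hT => hT (h.of_injective Fin.val_injective),
    fun ⟨_, hk⟩ => hk (h.of_injective Fin.val_injective)⟩
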